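/- Let $k\ge 2$ and let $H=(V,E)$ be a finite $k$-uniform hypergraph without multiple edges, each of whose edges $P\in E$ is given as a sequence $(p_1,\dots,p_k)$ of its $k$ distinct vertices (the orders on different edges are unrelated; distinct edges have distinct vertex sets). Let $\Delta$ be a nonnegative integer such that every vertex of $H$ belongs to at most $\Delta$ edges, and let $$I=\{|P\setminus Q| : P,Q\in E\}\cap\{1,\dots,k-1\},$$ where edges are regarded as vertex sets. Let $\Pi$ be a set of permutations of $[k]=\{1,\dots,k\}$ such that $\sigma\in\Pi$ implies $\sigma^{-1}\in\Pi$, and let $\pi=|\Pi|$. Put $q_1=1$ and $q_i=\frac{i}{i-1}\sqrt[i]{i-1}$ for $i>1$. Suppose that every vertex $v$ of $H$ has a list $L_v$ of at least $R$ colors, where $R$ is an integer with $$R\ \ge\ 1+\left\lfloor \sum_{i\in I} q_i\,\sqrt[i]{\Delta(\Delta-1)\,\pi\left(1+(k-1)\min\left\{1,\frac{|I|}{k-i}\right\}\right)}\right\rfloor .$$ Then there is a coloring $\varphi$ of $V$ with $\varphi(v)\in L_v$ for every $v\in V$ such that for any two distinct edges $P=(p_1,\dots,p_k)$ and $Q=(r_1,\dots,r_k)$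 of $H$ that share a vertex, the color sequences of $P$ and $Q$ are not $\Pi$-compatible, i.e. there is no $\sigma\in\Pi$ with $\varphi(p_{\sigma(j)})=\varphi(r_j)$ for all $j\in[k]$. -/

import Mathlib

/-- The set of vertices that occur in a sequence of `k` distinct vertices. -/
def seqVerts {V : Type*} {k : ℕ} (P : Fin k ↪ V) : Finset V :=
  Finset.univ.map P

/-- A `k`-uniform sequence hypergraph on the vertex set `V`: a `k`-uniform hypergraph without
multiple edges, each of whose edges is ordered as a sequence of `k` distinct vertices. The orders
chosen on distinct edges are unrelated. -/
structure SeqHypergraph (V : Type*) (k : ℕ) where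
  /-- the edges, each listed in its order -/
  edges : Finset (Fin k ↪ V)
  /-- no multiple edges: distinct edges have distinct vertex sets -/
  eq_of_seqVerts_eq : ∀ P ∈ edges, ∀ Q ∈ edges, seqVerts P = seqVerts Q → P = Q

namespace SeqHypergraph

/-- The degree of a vertex: the number of edges that contain it. -/
def degree {V : Type*} [DecidableEq V] {k : ℕ} (H : SeqHypergraph V k) (v : V) : ℕ :=
  (H.edges.filter (fun P => v ∈ seqVerts P)).card

/-- The maximum degree (`0` if there are no vertices). -/
def maxDegree {V : Type*} [Fintype V] [DecidableEq V] {k : ℕ} (H : SeqHypergraph V k) : ℕ :=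
  Finset.univ.sup H.degree

/-- `I(H) = {|P \ Q| : P, Q ∈ E} ∩ {1, …, k - 1}`. -/
def diffSizes {V : Type*} [DecidableEq V] {k : ℕ} (H : SeqHypergraph V k) : Finset ℕ :=
  (Finset.Icc 1 (k - 1)).filter
    (fun i => ∃ P ∈ H.edges, ∃ Q ∈ H.edges, (seqVerts P \ seqVerts Q).card = i)

end SeqHypergraph

/-- Two sequences `B`, `D` of length `k` are `Π`-compatible if some `σ ∈ Π`, permuting the
positions, turns `B` into `D`. -/
def PermCompatible {C : Type*} {k : ℕ} (S : Finset (Equiv.Perm (Fin k))) (B D : Fin k → C) : Prop :=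
  ∃ σ ∈ S, (fun j => B (σ j)) = D

/-- A vertex coloring is `Π`-distinguishing if for any two (distinct) intersecting edges `P`, `Q`
the sequences of colors on `P` and on `Q` are not `Π`-compatible. -/
def SeqHypergraph.IsDistinguishing {V C : Type*} {k : ℕ} (H : SeqHypergraph V k)
    (S : Finset (Equiv.Perm (Fin k))) (φ : V → C) : Prop :=
  ∀ P ∈ H.edges, ∀ Q ∈ H.edges, P ≠ Q → (∃ v, v ∈ seqVerts P ∧ v ∈ seqVerts Q) →
    ¬ PermCompatible S (fun j => φ (P j)) (fun j => φ (Q j))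

/-- `q₁ = 1` and `qᵢ = (i / (i - 1)) * (i - 1) ^ (1 / i)` for `i > 1`. -/
noncomputable def qCoeff (i : ℕ) : ℝ :=
  if i = 1 then 1 else ((i : ℝ) / ((i : ℝ) - 1)) * ((i : ℝ) - 1) ^ (1 / (i : ℝ))

/-! The proof counts colorings in the style of the local lemma. For two intersecting edges `P`, `Q`
and `σ ∈ Π`, the bad event equates the colors of `P` at positions `σ j` with those of `Q` at `j`. It
determines a coloring from its values off a set of `|P \ Q|` vertices, which may be chosen to
contain any constrained vertex of `P` (`exists_determined_set`). If each new vertex multiplies the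
number of good partial colorings by at least `x`, then at most a fraction `x^(1-i)` of the good
colorings is lost to a bad event with `|P \ Q| = i`. With at most `N i` such events at each vertex,
the induction closes once `x + ∑ N i / x^(i-1) ≤ R`. The constants `qᵢ` come from minimizing `y + N
i / y^(i-1)` separately for each `i`. -/

open Finset

/-! ### Counting colorings vertex by vertex -/

/-- Counting form of the local lemma: if the events in `F v` cover the events of `E` whose support
contains `v`, each of them determines the values on a set `T` of `size e` vertices containing `v`,
and the weights satisfy `hsum`, then all the events can be avoided. -/
theorem exists_avoiding_of_counting {V ι : Type*} [Fintype V] [DecidableEq V] {R : ℕ}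
    (E : Finset ι) (supp : ι → Finset V) (occ : ι → (V → Fin R) → Prop) (F : V → Finset ι)
    (size : ι → ℕ) (x : ℝ) (hx : 0 < x)
    (hne : ∀ e ∈ E, (supp e).Nonempty)
    (hdep : ∀ e ∈ E, ∀ f g, (∀ v ∈ supp e, f v = g v) → occ e f → occ e g)
    (hF : ∀ v, ∀ e ∈ E, v ∈ supp e → ∀ f, occ e f → ∃ e' ∈ F v, supp e' ⊆ supp e ∧ occ e' f)
    (hT : ∀ v, ∀ e ∈ F v, ∃ T ⊆ supp e, v ∈ T ∧ T.card = size e ∧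
      ∀ f g, occ e f → occ e g → (∀ u, u ∉ T → f u = g u) → f = g)
    (hsum : ∀ v, x + ∑ e ∈ F v, (x ^ (size e - 1))⁻¹ ≤ R) (hR : 0 < R) :
    ∃ f : V → Fin R, ∀ e ∈ E, ¬ occ e f := by
  classical
  -- Colorings are total, so the good colorings of `X` alone number `|A X| / R^|V \ X|`. The powers
  -- of `R` in `key` correct for this.
  let A : Finset V → Finset (V → Fin R) := fun X =>
    univ.filter fun f => ∀ e ∈ E, supp e ⊆ X → ¬ occ e f
  have hRr : (0 : ℝ) < R := by exact_mod_cast hR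
  have key : ∀ X Y, Y ⊆ X →
      x ^ (X \ Y).card * ((A Y).card : ℝ) ≤ (R : ℝ) ^ (X \ Y).card * ((A X).card : ℝ) := by
    intro X
    induction X using Finset.strongInduction with
    | H X ih =>
    intro Y hYX
    by_cases hXY : X ⊆ Y
    · rw [subset_antisymm hYX hXY]; simp
    obtain ⟨v, hvX, hvY⟩ := Finset.not_subset.1 hXY
    set Z := X.erase v with hZ
    have hZX : Z ⊂ X := Finset.erase_ssubset hvX
    have hYZ : Y ⊆ Z := Finset.subset_erase.2 ⟨hYX, hvY⟩
    have hcard : (X \ Y).card = (Z \ Y).card + 1 := by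
      rw [hZ, Finset.erase_sdiff_comm, Finset.card_erase_add_one]
      simp [hvX, hvY]
    let B : ι → Finset (V → Fin R) := fun e =>
      univ.filter fun f => f ∈ A Z ∧ supp e ⊆ X ∧ occ e f
    have hB : ∀ e ∈ F v, ((B e).card : ℝ) * R ≤ (A Z).card * (x ^ (size e - 1))⁻¹ := by
      intro e he
      by_cases hs : supp e ⊆ X
      swap
      · have : B e = ∅ := by
          ext f; simp [B, hs]
        rw [this]; simp; positivity
      obtain ⟨T, hTs, hvT, hTc, hdet⟩ := hT v e he
      -- Recoloring `T` arbitrarily keeps every event inside `Z \ T` avoided. Nothing is lost, since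
      -- the occurrence of `e` recovers the coloring from its values off `T`.
      have h1 : (B e).card * R ^ T.card ≤ (A (Z \ T)).card := by
        have : (B e).card * R ^ T.card = (B e ×ˢ (univ : Finset (T → Fin R))).card := by
          simp [Finset.card_product]
        rw [this]
        apply Finset.card_le_card_of_injOn
          (fun p => fun u => if h : u ∈ T then p.2 ⟨u, h⟩ else p.1 u)
        · rintro ⟨f, c⟩ hp
          simp only [Finset.coe_product, Set.mem_prod, Finset.mem_coe] at hp
          have hf : f ∈ A Z := (Finset.mem_filter.1 hp.1).2.1
          simp only [Finset.mem_coe, A, Finset.mem_filter, Finset.mem_univ, true_and] at hf ⊢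
          intro e' he' hs' ho
          refine hf e' he' (hs'.trans Finset.sdiff_subset) (hdep e' he' _ _ ?_ ho)
          intro u hu
          have : u ∉ T := (Finset.mem_sdiff.1 (hs' hu)).2
          simp [this]
        · rintro ⟨f, c⟩ hp ⟨g, d⟩ hq h
          simp only [Finset.coe_product, Set.mem_prod, Finset.mem_coe] at hp hq
          have hf := (Finset.mem_filter.1 hp.1).2.2.2
          have hg := (Finset.mem_filter.1 hq.1).2.2.2
          have hfg : f = g := by
            refine hdet f g hf hg fun u hu => ?_
            simpa [hu] using congrFun h u
          have hcd : c = d := by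
            ext ⟨u, hu⟩
            simpa [hu] using congrArg Fin.val (congrFun h u)
          rw [hfg, hcd]
      have h2 := ih Z hZX (Z \ T) Finset.sdiff_subset
      -- The vertex `v` lies in `T` but not in `Z`, hence the exponent `size e - 1`.
      have h3 : (Z \ (Z \ T)).card + 1 = size e := by
        have : Z \ (Z \ T) = T.erase v := by
          ext u
          simp only [hZ, Finset.mem_sdiff, Finset.mem_erase]
          have := @hTs u
          have := @hs u
          tauto
        rw [this, Finset.card_erase_add_one hvT, hTc]
      obtain ⟨m, hm⟩ : ∃ m, (Z \ (Z \ T)).card = m := ⟨_, rfl⟩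
      rw [hm] at h2 h3
      rw [hTc, ← h3] at h1
      rw [← h3, Nat.add_sub_cancel, ← div_eq_mul_inv, le_div_iff₀ (by positivity)]
      have h1' : ((B e).card : ℝ) * R ^ (m + 1) ≤ (A (Z \ T)).card := by exact_mod_cast h1
      have h4 : (R : ℝ) ^ m * ((B e).card * R * x ^ m) ≤ R ^ m * (A Z).card := by
        calc (R : ℝ) ^ m * ((B e).card * R * x ^ m)
            = x ^ m * ((B e).card * R ^ (m + 1)) := by ring
          _ ≤ x ^ m * (A (Z \ T)).card := by gcongr
          _ ≤ _ := h2
      exact le_of_mul_le_mul_left h4 (by positivity)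
    have hcov : A Z ⊆ A X ∪ (F v).biUnion B := by
      intro f hf
      by_cases hfX : f ∈ A X
      · exact Finset.mem_union_left _ hfX
      apply Finset.mem_union_right
      have hfX' := hfX
      simp only [A, Finset.mem_filter, Finset.mem_univ, true_and] at hfX' hf
      push Not at hfX'
      obtain ⟨e, he, hs, ho⟩ := hfX'
      have hv : v ∈ supp e := by
        by_contra hv
        exact hf e he (Finset.subset_erase.2 ⟨hs, hv⟩) ho
      obtain ⟨e', he', hs', ho'⟩ := hF v e he hv f ho
      refine Finset.mem_biUnion.2 ⟨e', he', ?_⟩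
      simp only [B, A, Finset.mem_filter, Finset.mem_univ, true_and]
      exact ⟨hf, hs'.trans hs, ho'⟩
    have hcovc : ((A Z).card : ℝ) ≤ (A X).card + ∑ e ∈ F v, ((B e).card : ℝ) := by
      have := (Finset.card_le_card hcov).trans ((Finset.card_union_le _ _).trans
        (Nat.add_le_add_left Finset.card_biUnion_le _))
      exact_mod_cast this
    have hstep : x * (A Z).card ≤ R * (A X).card := by
      have h5 : (∑ e ∈ F v, ((B e).card : ℝ)) * R
          ≤ (A Z).card * ∑ e ∈ F v, (x ^ (size e - 1))⁻¹ := by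
        rw [Finset.sum_mul, Finset.mul_sum]
        exact Finset.sum_le_sum hB
      have h6 := mul_le_mul_of_nonneg_left (hsum v) (Nat.cast_nonneg (α := ℝ) (A Z).card)
      have h7 := mul_le_mul_of_nonneg_right hcovc hRr.le
      linarith
    calc x ^ (X \ Y).card * ((A Y).card : ℝ)
        = x * (x ^ (Z \ Y).card * (A Y).card) := by rw [hcard]; ring
      _ ≤ x * (R ^ (Z \ Y).card * (A Z).card) :=
        mul_le_mul_of_nonneg_left (ih Z hZX Y hYZ) hx.le
      _ = R ^ (Z \ Y).card * (x * (A Z).card) := by ring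
      _ ≤ R ^ (Z \ Y).card * (R * (A X).card) := by gcongr
      _ = _ := by rw [hcard]; ring
  have h0 : 0 < (A ∅).card := by
    refine Finset.card_pos.2 ⟨fun _ => ⟨0, hR⟩, ?_⟩
    simp only [A, Finset.mem_filter, Finset.mem_univ, true_and, Finset.subset_empty]
    exact fun e he h => absurd h (hne e he).ne_empty
  have h1 := key univ ∅ (Finset.empty_subset _)
  have h2 : 0 < ((A univ).card : ℝ) := by
    have h0' : (0 : ℝ) < (A ∅).card := by exact_mod_cast h0
    exact pos_of_mul_pos_right (lt_of_lt_of_le (by positivity) h1) (by positivity)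
  obtain ⟨f, hf⟩ := Finset.card_pos.1 (by exact_mod_cast h2 : 0 < (A univ).card)
  exact ⟨f, fun e he => (Finset.mem_filter.1 hf).2 e he (Finset.subset_univ _)⟩

/-! ### Optimizing the growth rate -/

/-- A suitable growth rate for the counting argument. -/
theorem exists_growth_rate (I : Finset ℕ) (hI : ∀ i ∈ I, 1 ≤ i) (N : ℕ → ℝ) (hN : ∀ i ∈ I, 0 ≤ N i)
    (R : ℝ) (hR : ∑ i ∈ I, qCoeff i * N i ^ (1 / (i : ℝ)) < R) :
    ∃ x : ℝ, 0 < x ∧ x + ∑ i ∈ I, N i * (x ^ (i - 1))⁻¹ ≤ R := by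
  -- For `i > 1` and `N i > 0`, `y i` minimizes `y + N i / y^(i-1)`, with minimum `qCoeff i * N i ^
  -- (1/i)`.
  let y : ℕ → ℝ := fun i => (((i : ℝ) - 1) * N i) ^ (1 / (i : ℝ))
  have hi1 : ∀ i ∈ I, (0 : ℝ) ≤ (i : ℝ) - 1 := fun i hi => by
    have : (1 : ℝ) ≤ i := by exact_mod_cast hI i hi
    linarith
  have hy : ∀ i ∈ I, 0 ≤ y i := fun i hi =>
    Real.rpow_nonneg (mul_nonneg (hi1 i hi) (hN i hi)) _
  set a := ∑ i ∈ I, qCoeff i * N i ^ (1 / (i : ℝ)) with ha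
  have hs : 0 ≤ ∑ i ∈ I, y i := Finset.sum_nonneg hy
  -- The slack `R - a` keeps `x` positive even if every `y i` is zero, as for `I = {1}`.
  set x := ∑ i ∈ I, y i + (R - a) with hx
  have hx0 : 0 < x := by linarith
  refine ⟨x, hx0, ?_⟩
  have hterm : ∀ i ∈ I, y i + N i * (x ^ (i - 1))⁻¹ ≤ qCoeff i * N i ^ (1 / (i : ℝ)) := by
    intro i hi
    obtain h1 | h1 := (hI i hi).eq_or_lt
    · subst h1
      simp [y, qCoeff]
    obtain ⟨m, rfl⟩ : ∃ m, i = m + 1 := ⟨i - 1, by omega⟩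
    have hm : (0 : ℝ) < m := by exact_mod_cast (by omega : 0 < m)
    have hm1 : m ≠ 0 := by omega
    have hyx : y (m + 1) ≤ x := by
      have := Finset.single_le_sum hy hi
      linarith
    have hypow : y (m + 1) ^ (m + 1) = m * N (m + 1) := by
      have h0 : 0 ≤ (m : ℝ) * N (m + 1) := mul_nonneg hm.le (hN _ hi)
      simp only [y, Nat.cast_add, Nat.cast_one, add_sub_cancel_right, one_div]
      have := Real.rpow_inv_natCast_pow h0 (Nat.succ_ne_zero m)
      simpa using this
    have hle : N (m + 1) * (x ^ m)⁻¹ ≤ y (m + 1) / m := by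
      rw [← div_eq_mul_inv, div_le_div_iff₀ (by positivity) hm, mul_comm _ (m : ℝ), ← hypow,
        pow_succ, mul_comm]
      have := hy _ hi
      gcongr
    have hq : qCoeff (m + 1) * N (m + 1) ^ (1 / ((m + 1 : ℕ) : ℝ)) = y (m + 1) + y (m + 1) / m := by
      have : m + 1 ≠ 1 := by omega
      simp only [qCoeff, this, if_false, y]
      rw [Real.mul_rpow (hi1 _ hi) (hN _ hi)]
      push_cast
      rw [add_sub_cancel_right]
      field_simp
    rw [hq, Nat.add_sub_cancel]
    linarith
  have := Finset.sum_le_sum hterm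
  rw [Finset.sum_add_distrib] at this
  linarith

/-! ### What compatibility of two edges determines -/

theorem mem_seqVerts {V : Type*} {k : ℕ} {P : Fin k ↪ V} {v : V} :
    v ∈ seqVerts P ↔ ∃ j, P j = v := by
  simp [seqVerts]

theorem card_seqVerts {V : Type*} {k : ℕ} (P : Fin k ↪ V) : (seqVerts P).card = k := by
  simp [seqVerts]

/-- The vertices that the compatibility of `P` and `Q` under `σ` really constrains. -/
def compatSupport {V : Type*} [DecidableEq V] {k : ℕ} (P Q : Fin k ↪ V) (σ : Equiv.Perm (Fin k)) :
    Finset V :=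
  (univ.filter fun j => P (σ j) ≠ Q j).biUnion fun j => {P (σ j), Q j}

theorem mem_compatSupport {V : Type*} [DecidableEq V] {k : ℕ} {P Q : Fin k ↪ V}
    {σ : Equiv.Perm (Fin k)} {v : V} :
    v ∈ compatSupport P Q σ ↔ ∃ j, P (σ j) ≠ Q j ∧ (v = P (σ j) ∨ v = Q j) := by
  simp [compatSupport]

theorem compatSupport_symm {V : Type*} [DecidableEq V] {k : ℕ} (P Q : Fin k ↪ V)
    (σ : Equiv.Perm (Fin k)) : compatSupport Q P σ⁻¹ ⊆ compatSupport P Q σ := by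
  intro v
  simp only [mem_compatSupport]
  rintro ⟨j, hj, hv⟩
  exact ⟨σ⁻¹ j, by simpa using hj.symm, by simpa using hv.symm⟩

/-- Compatible colorings of two edges are determined on some set of `|P \ Q|` vertices that
contains a given vertex of `P` in the support. -/
theorem exists_determined_set {V α C : Type*} [DecidableEq V] {k : ℕ} (P Q : Fin k ↪ V)
    (σ : Equiv.Perm (Fin k)) (col : V → α → C) (hcol : ∀ v, Function.Injective (col v)) {v : V}
    (hv : v ∈ compatSupport P Q σ) (hvP : v ∈ seqVerts P)
    (hPQ : 1 ≤ (seqVerts P \ seqVerts Q).card) :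
    ∃ T ⊆ compatSupport P Q σ, v ∈ T ∧ T.card = (seqVerts P \ seqVerts Q).card ∧
      ∀ f g : V → α, (∀ j, col (P (σ j)) (f (P (σ j))) = col (Q j) (f (Q j))) →
        (∀ j, col (P (σ j)) (g (P (σ j))) = col (Q j) (g (Q j))) →
        (∀ u, u ∉ T → f u = g u) → f = g := by
  -- If `v ∈ Q`, it takes the place of one vertex of `P \ Q`. Either way `v` is the only vertex of
  -- `T` that can lie in `Q`.
  obtain ⟨T, hvT, hT, hcard⟩ := Finset.exists_subsuperset_card_eq
    (s := {v}) (t := insert v (seqVerts P \ seqVerts Q)) (by simp)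
    (n := (seqVerts P \ seqVerts Q).card) (by simpa using hPQ)
    (Finset.card_le_card (Finset.subset_insert _ _))
  have hstep : ∀ f g : V → α, (∀ j, col (P (σ j)) (f (P (σ j))) = col (Q j) (f (Q j))) →
      (∀ j, col (P (σ j)) (g (P (σ j))) = col (Q j) (g (Q j))) →
      ∀ j, f (Q j) = g (Q j) → f (P (σ j)) = g (P (σ j)) := by
    intro f g hf hg j h
    apply hcol (P (σ j))
    rw [hf, hg, h]
  have hpos : ∀ u ∈ seqVerts P, ∃ j, P (σ j) = u := by
    intro u hu
    obtain ⟨j, rfl⟩ := mem_seqVerts.1 hu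
    exact ⟨σ⁻¹ j, by simp⟩
  have hQT : ∀ j, Q j ∈ T → Q j = v := by
    intro j hj
    obtain h | h := Finset.mem_insert.1 (hT hj)
    · exact h
    · exact absurd (mem_seqVerts.2 ⟨j, rfl⟩) (Finset.mem_sdiff.1 h).2
  obtain ⟨i, hi⟩ := hpos v hvP
  have hiv : Q i ≠ v := by
    intro h
    obtain ⟨j, hj, h' | h'⟩ := mem_compatSupport.1 hv
    · obtain rfl : i = j := σ.injective (P.injective (hi.trans h'))
      exact hj (hi.trans h.symm)
    · obtain rfl : i = j := Q.injective (h.trans h')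
      exact hj (hi.trans h')
  refine ⟨T, fun u hu => ?_, by simpa using hvT, hcard, fun f g hf hg hfg => ?_⟩
  · obtain rfl | h := Finset.mem_insert.1 (hT hu)
    · exact hv
    obtain ⟨hP, hQ⟩ := Finset.mem_sdiff.1 h
    obtain ⟨j, rfl⟩ := hpos u hP
    exact mem_compatSupport.2 ⟨j, fun h => hQ (mem_seqVerts.2 ⟨j, h.symm⟩), Or.inl rfl⟩
  -- The partner `Q i` of `v` differs from `v`, hence is outside `T` and fixes the color of `v`.
  -- Every other vertex of `T` has its partner outside `T` or equal to `v`.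
  · have hvv : f v = g v := by
      rw [← hi]
      exact hstep f g hf hg i (hfg _ fun h => hiv (hQT i h))
    funext u
    by_cases hu : u ∈ T
    swap
    · exact hfg u hu
    obtain rfl | h := Finset.mem_insert.1 (hT hu)
    · exact hvv
    obtain ⟨j, rfl⟩ := hpos u (Finset.mem_sdiff.1 h).1
    apply hstep f g hf hg j
    by_cases hj : Q j ∈ T
    · rw [hQT j hj]; exact hvv
    · exact hfg _ hj

/-! ### Counting edges at a given distance from `P` -/

namespace SeqHypergraph

variable {V : Type*} [DecidableEq V] {k : ℕ}

/-- The edges other than `P` that miss exactly `i` vertices of `P`. -/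
noncomputable def edgesAt (H : SeqHypergraph V k) (P : Fin k ↪ V) (i : ℕ) : Finset (Fin k ↪ V) :=
  open Classical in
  H.edges.filter fun Q => P ≠ Q ∧ (seqVerts P \ seqVerts Q).card = i

/-- At most `Δ - 1` of these edges contain `v`, as `P` itself is excluded. Each of the others meets
`P` in `k - i` of its `k - 1` vertices besides `v`, so incidences are counted twice. -/
theorem card_edgesAt_mul_le (H : SeqHypergraph V k) {Δ : ℕ} (hΔ : ∀ v, H.degree v ≤ Δ)
    {P : Fin k ↪ V} (hP : P ∈ H.edges) {v : V} (hv : v ∈ seqVerts P) (i : ℕ) :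
    (H.edgesAt P i).card * (k - i) ≤ (Δ - 1) * (k - i) + (k - 1) * (Δ - 1) := by
  classical
  have hdeg : ∀ u ∈ seqVerts P, ((H.edgesAt P i).filter fun Q => u ∈ seqVerts Q).card ≤ Δ - 1 := by
    intro u hu
    refine Nat.le_sub_one_of_lt (lt_of_lt_of_le (Finset.card_lt_card ?_) (hΔ u))
    refine Finset.ssubset_iff_subset_ne.2 ⟨?_, fun h => ?_⟩
    · exact Finset.filter_subset_filter _ (Finset.filter_subset _ _)
    · have : P ∈ H.edges.filter fun Q => u ∈ seqVerts Q := Finset.mem_filter.2 ⟨hP, hu⟩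
      rw [← h] at this
      simp [edgesAt] at this
  have hsplit := Finset.card_filter_add_card_filter_not (s := H.edgesAt P i)
    (fun Q => v ∈ seqVerts Q)
  rw [← hsplit, add_mul]
  refine Nat.add_le_add (Nat.mul_le_mul_right _ (hdeg v hv)) ?_
  set D := (H.edgesAt P i).filter fun Q => v ∉ seqVerts Q
  have hcard : ((seqVerts P).erase v).card = k - 1 := by
    rw [Finset.card_erase_of_mem hv, card_seqVerts]
  rw [← hcard]
  refine Finset.card_mul_le_card_mul' (fun u Q => u ∈ seqVerts Q) (fun Q hQ => ?_) fun u hu => ?_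
  · obtain ⟨hQ1, hvQ⟩ := Finset.mem_filter.1 hQ
    have hQi : (seqVerts P \ seqVerts Q).card = i := (Finset.mem_filter.1 hQ1).2.2
    have h := Finset.card_sdiff_add_card_inter (seqVerts P) (seqVerts Q)
    rw [card_seqVerts, hQi] at h
    have : k - i = (seqVerts P ∩ seqVerts Q).card := by omega
    rw [this]
    refine Finset.card_le_card fun u hu => ?_
    obtain ⟨h1, h2⟩ := Finset.mem_inter.1 hu
    refine Finset.mem_filter.2 ⟨Finset.mem_erase.2 ⟨?_, h1⟩, h2⟩
    rintro rfl
    exact hvQ h2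
  · refine (Finset.card_le_card ?_).trans (hdeg u (Finset.mem_of_mem_erase hu))
    exact Finset.filter_subset_filter _ (Finset.filter_subset _ _)

theorem card_edgesAt_le (H : SeqHypergraph V k) {Δ : ℕ} (hΔ : ∀ v, H.degree v ≤ Δ)
    {P : Fin k ↪ V} (hP : P ∈ H.edges) {v : V} (hv : v ∈ seqVerts P) {i : ℕ} (hik : i < k)
    {c : ℝ} (hc : 1 ≤ c) :
    ((H.edgesAt P i).card : ℝ) ≤ ((Δ : ℝ) - 1) * (1 + ((k : ℝ) - 1) * min 1 (c / ((k : ℝ) - i))) := by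
  have hΔ1 : 1 ≤ Δ := by
    refine le_trans (Finset.card_pos.2 ⟨P, ?_⟩) (hΔ v)
    exact Finset.mem_filter.2 ⟨hP, hv⟩
  have h := H.card_edgesAt_mul_le hΔ hP hv i
  have h' : ((H.edgesAt P i).card : ℝ) * ((k : ℝ) - i) ≤
      ((Δ : ℝ) - 1) * ((k : ℝ) - i) + ((k : ℝ) - 1) * ((Δ : ℝ) - 1) := by
    have := (Nat.cast_le (α := ℝ)).2 h
    push_cast [Nat.cast_sub hik.le, Nat.cast_sub hΔ1, Nat.cast_sub (by omega : 1 ≤ k)] at this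
    exact this
  have hki : (1 : ℝ) ≤ (k : ℝ) - i := by
    have : ((i + 1 : ℕ) : ℝ) ≤ k := by exact_mod_cast hik
    push_cast at this
    linarith
  -- The double count gives the sharper `1 / (k - i)`; `c`, later `|I|`, only weakens it.
  have hmin : 1 / ((k : ℝ) - i) ≤ min 1 (c / ((k : ℝ) - i)) := by
    refine le_min ((div_le_one (by linarith)).2 hki) ?_
    gcongr
  have hk1 : (0 : ℝ) ≤ (k : ℝ) - 1 := by linarith [Nat.cast_nonneg (α := ℝ) i]
  have hD : (0 : ℝ) ≤ (Δ : ℝ) - 1 := by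
    have : (1 : ℝ) ≤ Δ := by exact_mod_cast hΔ1
    linarith
  calc ((H.edgesAt P i).card : ℝ)
      ≤ (((Δ : ℝ) - 1) * ((k : ℝ) - i) + ((k : ℝ) - 1) * ((Δ : ℝ) - 1)) / ((k : ℝ) - i) :=
        (le_div_iff₀ (by linarith)).2 h'
    _ = ((Δ : ℝ) - 1) * (1 + ((k : ℝ) - 1) * (1 / ((k : ℝ) - i))) := by
        have : (k : ℝ) - i ≠ 0 := by linarith
        field_simp
    _ ≤ _ := by gcongr

end SeqHypergraph

/-! ### Assembling the bounds -/

theorem theorem4p7 {V C : Type*} [Fintype V] [DecidableEq V] (k : ℕ) (hk : 2 ≤ k)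
    (H : SeqHypergraph V k) (Δ : ℕ) (hΔ : H.maxDegree ≤ Δ)
    (S : Finset (Equiv.Perm (Fin k))) (hS : ∀ σ ∈ S, σ⁻¹ ∈ S)
    (R : ℕ) (L : V → Set C) (hL : ∀ v, (R : ℕ∞) ≤ (L v).encard)
    (hR : 1 + ⌊∑ i ∈ H.diffSizes, qCoeff i *
        ((Δ : ℝ) * ((Δ : ℝ) - 1) * (S.card : ℝ) *
          (1 + ((k : ℝ) - 1) * min 1 ((H.diffSizes.card : ℝ) / ((k : ℝ) - (i : ℝ))))) ^
            (1 / (i : ℝ))⌋₊ ≤ R) :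
    ∃ φ : V → C, (∀ v, φ v ∈ L v) ∧ H.IsDistinguishing S φ := by
  classical
  have hdeg : ∀ v, H.degree v ≤ Δ := fun v =>
    (Finset.le_sup (f := H.degree) (Finset.mem_univ v)).trans hΔ
  set I := H.diffSizes with hIdef
  let N : ℕ → ℝ := fun i => (Δ : ℝ) * ((Δ : ℝ) - 1) * (S.card : ℝ) *
    (1 + ((k : ℝ) - 1) * min 1 ((I.card : ℝ) / ((k : ℝ) - (i : ℝ))))
  have hI : ∀ i ∈ I, 1 ≤ i ∧ i < k := by
    intro i hi
    have := Finset.mem_Icc.1 (Finset.mem_filter.1 hi).1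
    omega
  have hdiff : ∀ P ∈ H.edges, ∀ Q ∈ H.edges, P ≠ Q → (∃ v, v ∈ seqVerts P ∧ v ∈ seqVerts Q) →
      (seqVerts P \ seqVerts Q).card ∈ I := by
    rintro P hP Q hQ hne ⟨v, hvP, hvQ⟩
    refine Finset.mem_filter.2 ⟨Finset.mem_Icc.2 ⟨?_, ?_⟩, P, hP, Q, hQ, rfl⟩
    · refine Finset.card_pos.2 (Finset.sdiff_nonempty.2 fun h => hne ?_)
      refine H.eq_of_seqVerts_eq P hP Q hQ (Finset.eq_of_subset_of_card_le h ?_)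
      rw [card_seqVerts, card_seqVerts]
    · have : (seqVerts P \ seqVerts Q).card < (seqVerts P).card := by
        refine Finset.card_lt_card (Finset.ssubset_iff_subset_ne.2 ⟨Finset.sdiff_subset, fun h => ?_⟩)
        rw [← h] at hvP
        exact (Finset.mem_sdiff.1 hvP).2 hvQ
      rw [card_seqVerts] at this
      omega
  have hk1 : (0 : ℝ) ≤ (k : ℝ) - 1 := by
    have : (2 : ℝ) ≤ k := by exact_mod_cast hk
    linarith
  have hN : ∀ i ∈ I, 0 ≤ N i := by
    intro i hi
    have hΔΔ : (0 : ℝ) ≤ (Δ : ℝ) * ((Δ : ℝ) - 1) := by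
      obtain rfl | h := Nat.eq_zero_or_pos Δ
      · simp
      · have : (1 : ℝ) ≤ Δ := by exact_mod_cast h
        exact mul_nonneg (by positivity) (by linarith)
    have hki : (0 : ℝ) ≤ (k : ℝ) - i := by
      have : (i : ℝ) ≤ k := by exact_mod_cast (hI i hi).2.le
      linarith
    have : (0 : ℝ) ≤ min 1 ((I.card : ℝ) / ((k : ℝ) - (i : ℝ))) :=
      le_min zero_le_one (by positivity)
    positivity
  have hR0 : 0 < R := by omega
  have hRA : ∑ i ∈ I, qCoeff i * N i ^ (1 / (i : ℝ)) < R :=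
    Nat.lt_of_floor_lt (by rw [← Nat.succ_le_iff, Nat.succ_eq_one_add]; exact hR)
  obtain ⟨x, hx, hxR⟩ := exists_growth_rate I (fun i hi => (hI i hi).1) N hN R hRA
  have hemb : ∀ v, ∃ c : Fin R → C, Function.Injective c ∧ ∀ a, c a ∈ L v := by
    intro v
    obtain ⟨t, htL, htc⟩ := Set.exists_subset_encard_eq (hL v)
    have hfin : t.Finite := Set.finite_of_encard_eq_coe htc
    have hnc : hfin.toFinset.card = R := by
      rw [hfin.encard_eq_coe_toFinset_card] at htc
      exact_mod_cast htc
    refine ⟨fun a => (hfin.toFinset.equivFinOfCardEq hnc).symm a, ?_, fun a => ?_⟩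
    · exact Subtype.val_injective.comp (Equiv.injective _)
    · exact htL (hfin.mem_toFinset.1 ((hfin.toFinset.equivFinOfCardEq hnc).symm a).2)
  choose col hcol hcolL using hemb
  let E : Finset ((Fin k ↪ V) × (Fin k ↪ V) × Equiv.Perm (Fin k)) :=
    (H.edges ×ˢ H.edges ×ˢ S).filter fun e =>
      e.1 ≠ e.2.1 ∧ ∃ v, v ∈ seqVerts e.1 ∧ v ∈ seqVerts e.2.1
  have hE : ∀ P Q σ, (P, Q, σ) ∈ E ↔ (P ∈ H.edges ∧ Q ∈ H.edges ∧ σ ∈ S) ∧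
      P ≠ Q ∧ ∃ v, v ∈ seqVerts P ∧ v ∈ seqVerts Q := by
    intro P Q σ
    simp [E]
  let supp : (Fin k ↪ V) × (Fin k ↪ V) × Equiv.Perm (Fin k) → Finset V := fun e =>
    compatSupport e.1 e.2.1 e.2.2
  let occ : (Fin k ↪ V) × (Fin k ↪ V) × Equiv.Perm (Fin k) → (V → Fin R) → Prop := fun e f =>
    ∀ j, col (e.1 (e.2.2 j)) (f (e.1 (e.2.2 j))) = col (e.2.1 j) (f (e.2.1 j))
  -- Only events with `v` in the first edge are kept: `(P, Q, σ)` and `(Q, P, σ⁻¹)` are the same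
  -- event, and closure of `S` under inverses saves a factor 2.
  let F : V → Finset ((Fin k ↪ V) × (Fin k ↪ V) × Equiv.Perm (Fin k)) := fun v =>
    E.filter fun e => v ∈ supp e ∧ v ∈ seqVerts e.1
  let size : (Fin k ↪ V) × (Fin k ↪ V) × Equiv.Perm (Fin k) → ℕ := fun e =>
    (seqVerts e.1 \ seqVerts e.2.1).card
  have hsize : ∀ e ∈ E, size e ∈ I := by
    rintro ⟨P, Q, σ⟩ he
    obtain ⟨⟨hP, hQ, -⟩, hne, hv⟩ := (hE P Q σ).1 he
    exact hdiff P hP Q hQ hne hv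
  have hcount : ∀ v, ∀ i ∈ I, (((F v).filter fun e => size e = i).card : ℝ) ≤ N i := by
    intro v i hi
    have hsub : ((F v).filter fun e => size e = i) ⊆
        ((H.edges.filter fun P => v ∈ seqVerts P).sigma fun P => H.edgesAt P i ×ˢ S).image
          fun p => (p.1, p.2.1, p.2.2) := by
      rintro ⟨P, Q, σ⟩ he
      obtain ⟨he1, hei⟩ := Finset.mem_filter.1 he
      obtain ⟨heE, -, hvP⟩ := Finset.mem_filter.1 he1
      obtain ⟨⟨hP, hQ, hσ⟩, hne, -⟩ := (hE P Q σ).1 heE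
      refine Finset.mem_image.2 ⟨⟨P, Q, σ⟩, ?_, rfl⟩
      refine Finset.mem_sigma.2 ⟨Finset.mem_filter.2 ⟨hP, hvP⟩, Finset.mem_product.2 ⟨?_, hσ⟩⟩
      exact Finset.mem_filter.2 ⟨hQ, hne, hei⟩
    have h1 := (Finset.card_le_card hsub).trans Finset.card_image_le
    rw [Finset.card_sigma] at h1
    have hIc : (1 : ℝ) ≤ I.card := by exact_mod_cast Finset.card_pos.2 ⟨i, hi⟩
    set w : ℝ := ((Δ : ℝ) - 1) *
      (1 + ((k : ℝ) - 1) * min 1 ((I.card : ℝ) / ((k : ℝ) - (i : ℝ)))) with hw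
    have h2 : ∀ P ∈ H.edges.filter fun P => v ∈ seqVerts P,
        ((H.edgesAt P i ×ˢ S).card : ℝ) ≤ w * S.card := by
      intro P hP
      obtain ⟨hP, hvP⟩ := Finset.mem_filter.1 hP
      rw [Finset.card_product, Nat.cast_mul]
      gcongr
      exact H.card_edgesAt_le hdeg hP hvP (hI i hi).2 hIc
    have hNw : N i = Δ * (w * S.card) := by simp only [N, hw]; ring
    have h3 : (((F v).filter fun e => size e = i).card : ℝ) ≤ H.degree v * (w * S.card) := by
      refine (Nat.cast_le.2 h1).trans ?_
      rw [Nat.cast_sum]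
      refine (Finset.sum_le_card_nsmul _ _ _ h2).trans (le_of_eq ?_)
      rw [nsmul_eq_mul]
      rfl
    rw [hNw]
    -- For `Δ = 0` the factor `w` can be negative, so its sign is taken from an edge through `v`.
    obtain h0 | h0 := Nat.eq_zero_or_pos (H.degree v)
    · rw [h0] at h3
      rw [← hNw]
      have := hN i hi
      simp only [Nat.cast_zero, zero_mul] at h3
      linarith
    · refine h3.trans ?_
      have hw0 : 0 ≤ w * S.card := by
        obtain ⟨P, hP⟩ := Finset.card_pos.1 h0
        exact (Nat.cast_nonneg _).trans (h2 P hP)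
      gcongr
      exact hdeg v
  have hsupp_ne : ∀ e ∈ E, (supp e).Nonempty := by
    rintro ⟨P, Q, σ⟩ he
    obtain ⟨⟨hP, hQ, -⟩, hne, -⟩ := (hE P Q σ).1 he
    obtain ⟨u, hu⟩ := Finset.card_pos.1 (hI _ (hsize _ he)).1
    obtain ⟨huP, huQ⟩ := Finset.mem_sdiff.1 hu
    obtain ⟨j, rfl⟩ := mem_seqVerts.1 huP
    refine ⟨P j, mem_compatSupport.2 ⟨σ⁻¹ j, fun h => huQ (mem_seqVerts.2 ⟨σ⁻¹ j, ?_⟩), ?_⟩⟩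
    · rw [← h]; simp
    · simp
  suffices h : ∃ f : V → Fin R, ∀ e ∈ E, ¬ occ e f by
    obtain ⟨f, hf⟩ := h
    refine ⟨fun v => col v (f v), fun v => hcolL v _, ?_⟩
    rintro P hP Q hQ hne hv ⟨σ, hσ, h⟩
    exact hf (P, Q, σ) ((hE P Q σ).2 ⟨⟨hP, hQ, hσ⟩, hne, hv⟩) fun j => congrFun h j
  refine exists_avoiding_of_counting E supp occ F size x hx hsupp_ne ?_ ?_ ?_ ?_ hR0
  · rintro ⟨P, Q, σ⟩ - f g hfg hf j
    by_cases h : P (σ j) = Q j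
    · simp only [h]
    · have h1 := hfg (P (σ j)) (mem_compatSupport.2 ⟨j, h, Or.inl rfl⟩)
      have h2 := hfg (Q j) (mem_compatSupport.2 ⟨j, h, Or.inr rfl⟩)
      have := hf j
      simp only at this ⊢
      rw [← h1, ← h2, this]
  · rintro v ⟨P, Q, σ⟩ he hv f hf
    by_cases hvP : v ∈ seqVerts P
    · exact ⟨(P, Q, σ), Finset.mem_filter.2 ⟨he, hv, hvP⟩, subset_rfl, hf⟩
    have hvQ : v ∈ seqVerts Q := by
      obtain ⟨j, -, h | h⟩ := mem_compatSupport.1 hv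
      · exact absurd (mem_seqVerts.2 ⟨_, h.symm⟩) hvP
      · exact mem_seqVerts.2 ⟨_, h.symm⟩
    obtain ⟨⟨hP, hQ, hσ⟩, hne, u, hu, hu'⟩ := (hE P Q σ).1 he
    have hv' : v ∈ compatSupport Q P σ⁻¹ := by
      apply compatSupport_symm Q P σ⁻¹
      simpa using hv
    refine ⟨(Q, P, σ⁻¹), Finset.mem_filter.2 ⟨(hE _ _ _).2 ⟨⟨hQ, hP, hS σ hσ⟩, hne.symm, u, hu', hu⟩,
      hv', hvQ⟩, compatSupport_symm P Q σ, fun j => ?_⟩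
    have := hf (σ⁻¹ j)
    simp only [show σ (σ⁻¹ j) = j from σ.apply_symm_apply j] at this
    exact this.symm
  · rintro v ⟨P, Q, σ⟩ he
    obtain ⟨heE, hv, hvP⟩ := Finset.mem_filter.1 he
    exact exists_determined_set P Q σ col hcol hv hvP (hI _ (hsize _ heE)).1
  · intro v
    refine le_trans (add_le_add_right ?_ x) hxR
    rw [← Finset.sum_fiberwise_of_maps_to (t := I) (g := size)
      (fun e he => hsize e (Finset.mem_filter.1 he).1)]
    refine Finset.sum_le_sum fun i hi => ?_
    have : ∑ e ∈ (F v).filter (fun e => size e = i), (x ^ (size e - 1))⁻¹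
        = ((F v).filter fun e => size e = i).card * (x ^ (i - 1))⁻¹ := by
      rw [← nsmul_eq_mul]
      refine Finset.sum_eq_card_nsmul fun e he => ?_
      rw [(Finset.mem_filter.1 he).2]
    rw [this]
    have := hcount v i hi
    gcongr
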